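/- Let $(X,\mathcal B)$ be a standard Borel space, $\mathcal F(X)$ the vector space of real-valued Borel functions on $X$, and $\sigma:X\to X$ a surjective Borel map. Let $\mathcal D\subseteq\mathcal F(X)$ be a linear subspace that contains the constants and is solid (if $f\in\mathcal D$, $g\in\mathcal F(X)$ and $|g|\le|f|$, then $g\in\mathcal D$); for example $\mathcal D=\mathcal F(X)$, or $\mathcal D$ = all bounded Borel functions. Let $(R,\sigma)$ be a transfer operator, i.e. $R:\mathcal D\to\mathcal F(X)$ is linear, positive ($f\ge 0\Rightarrow R(f)\ge 0$), satisfies $R((f\circ\sigma)g)=f\,R(g)$ for all $f\in\mathcal F(X)$ and $g\in\mathcal D$ with $(f\circ\sigma)g\in\mathcal D$, and is order continuous: if $f_n\in\mathcal D$ and there are $h_n\in\mathcal D$ decreasing pointwise to $0$ with $|f_n|\le h_n$ for all large $n$, then there are $k_n\in\mathcal F(X)$ decreasing pointwise to $0$ with $|R(f_n)|\le k_n$ for all large $n$. Let $M(X)$ be the set of $\sigma$-finite Borel measures on $X$. For $\lambda\in M(X)$ let $\lambda R\in M(X)$ be the measure $(\lambda R)(A)=\int_X R(\chi_A)\,d\lambda$,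 and put $\mathcal L(R)=\{\lambda\in M(X):\lambda R\ll\lambda\}$. Let $\mathcal H(X)$ be the universal Hilbert space: its elements are the classes $f\sqrt{d\mu}$ of pairs $(f,\mu)$ with $\mu\in M(X)$ and $f\in L^2(\mu)$ real-valued, where $(f,\mu)\sim(g,\nu)$ if for some $\kappa\in M(X)$ with $\mu,\nu\ll\kappa$ one has $f\sqrt{d\mu/d\kappa}=g\sqrt{d\nu/d\kappa}$ $\kappa$-a.e. The operations are $f\sqrt{d\mu}+g\sqrt{d\nu}=\bigl(f\sqrt{d\mu/d\kappa}+g\sqrt{d\nu/d\kappa}\bigr)\sqrt{d\kappa}$ and $c\,(f\sqrt{d\mu})=(cf)\sqrt{d\mu}$, and the inner product is $\langle f\sqrt{d\mu},g\sqrt{d\nu}\rangle=\int_X fg\sqrt{d\mu/d\kappa}\sqrt{d\nu/d\kappa}\,d\kappa$, for any $\kappa\in M(X)$ with $\mu,\nu\ll\kappa$. For $\lambda\in M(X)$ let $\mathcal H(\lambda)=\{f\sqrt{d\lambda}:f\in L^2(\lambda)\}$, the image of the isometric embedding $L^2(\lambda)\to\mathcal H(X)$, $f\mapsto f\sqrt{d\lambda}$.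 Let $\widehat S$ be the (well-defined, linear) operator $$\widehat S(f\sqrt{d\lambda})=(f\circ\sigma)\sqrt{d(\lambda R)}$$ in $\mathcal H(X)$, with domain the set of all classes $f\sqrt{d\lambda}$ such that $f\circ\sigma\in L^2(\lambda R)$. Then: 1. $\widehat S$ is an isometry if and only if $R(\mathbf 1)=\mathbf 1$ (everywhere on $X$). More precisely, $\widehat S$ is isometric on its domain if and only if $R(\mathbf 1)=\mathbf 1$, and in that case its domain is all of $\mathcal H(X)$. 2. If $\lambda\in\mathcal L(R)$, then $\mathcal H(\lambda)$ is invariant under $\widehat S$: if $u\in\mathcal H(\lambda)$ lies in the domain of $\widehat S$, then $\widehat Su\in\mathcal H(\lambda)$. (Here $R(\mathbf 1)=\mathbf 1$ is not assumed.) -/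

import Mathlib

open MeasureTheory Filter Topology
open scoped ENNReal

namespace UniversalHilbert

noncomputable section

/-- The function `√(dμ/dκ)`. -/
def sqrtRN {X : Type*} [MeasurableSpace X] (μ κ : Measure X) (x : X) : ℝ :=
  Real.sqrt (μ.rnDeriv κ x).toReal

theorem measurable_sqrtRN {X : Type*} [MeasurableSpace X] (μ κ : Measure X) :
    Measurable (sqrtRN μ κ) :=
  (Measure.measurable_rnDeriv μ κ).ennreal_toReal.sqrt

theorem ae_eq_iff_mul_sqrtRN {X : Type*} [MeasurableSpace X] {μ κ : Measure X}
    [SigmaFinite μ] [SigmaFinite κ] (h : μ ≪ κ) (f g : X → ℝ) :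
    f =ᵐ[μ] g ↔ (fun x => f x * sqrtRN μ κ x) =ᵐ[κ] fun x => g x * sqrtRN μ κ x := by
  have e : f =ᵐ[μ] g ↔ f =ᵐ[κ.withDensity (μ.rnDeriv κ)] g := by
    rw [Measure.withDensity_rnDeriv_eq _ _ h]
  rw [e, Filter.EventuallyEq, ae_withDensity_iff (Measure.measurable_rnDeriv μ κ)]
  have : ∀ᵐ x ∂κ, ((μ.rnDeriv κ x ≠ 0 → f x = g x) ↔
      f x * sqrtRN μ κ x = g x * sqrtRN μ κ x) := by
    filter_upwards [Measure.rnDeriv_lt_top μ κ] with x hx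
    have : sqrtRN μ κ x = 0 ↔ μ.rnDeriv κ x = 0 := by
      rw [sqrtRN, Real.sqrt_eq_zero ENNReal.toReal_nonneg, ENNReal.toReal_eq_zero_iff]
      simp [hx.ne]
    rw [mul_eq_mul_right_iff, this]
    tauto
  constructor
  · intro h1; filter_upwards [h1, this] with x h2 h3 using h3.1 h2
  · intro h1; filter_upwards [h1, this] with x h2 h3 using h3.2 h2

theorem sqrtRN_chain {X : Type*} [MeasurableSpace X] {μ ν κ : Measure X}
    [SigmaFinite μ] [SigmaFinite ν] [SigmaFinite κ] (h : μ ≪ ν) :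
    (fun x => sqrtRN μ ν x * sqrtRN ν κ x) =ᵐ[κ] sqrtRN μ κ := by
  filter_upwards [Measure.rnDeriv_mul_rnDeriv (κ := κ) h] with x hx
  simp only [sqrtRN, ← hx, Pi.mul_apply, ENNReal.toReal_mul]
  rw [Real.sqrt_mul ENNReal.toReal_nonneg]

theorem sqrtRN_self {X : Type*} [MeasurableSpace X] (μ : Measure X) [SigmaFinite μ] :
    sqrtRN μ μ =ᵐ[μ] fun _ => 1 := by
  filter_upwards [Measure.rnDeriv_self μ] with x hx
  simp [sqrtRN, hx]

theorem integral_mul_sqrtRN {X : Type*} [MeasurableSpace X] {μ κ : Measure X}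
    [SigmaFinite μ] [SigmaFinite κ] (h : μ ≪ κ) (f g : X → ℝ) :
    ∫ x, (f x * sqrtRN μ κ x) * (g x * sqrtRN μ κ x) ∂κ = ∫ x, f x * g x ∂μ := by
  rw [← integral_rnDeriv_smul h]
  congr 1
  ext x
  have : sqrtRN μ κ x * sqrtRN μ κ x = (μ.rnDeriv κ x).toReal :=
    Real.mul_self_sqrt ENNReal.toReal_nonneg
  rw [smul_eq_mul, ← this]; ring

theorem aesm_mul_sqrtRN {X : Type*} [MeasurableSpace X] {μ κ : Measure X}
    [SigmaFinite μ] [SigmaFinite κ] (h : μ ≪ κ) {f : X → ℝ} (hf : AEStronglyMeasurable f μ) :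
    AEStronglyMeasurable (fun x => f x * sqrtRN μ κ x) κ :=
  ⟨fun x => hf.mk f x * sqrtRN μ κ x,
    hf.stronglyMeasurable_mk.mul (measurable_sqrtRN μ κ).stronglyMeasurable,
    (ae_eq_iff_mul_sqrtRN h _ _).1 hf.ae_eq_mk⟩

theorem memLp_mul_sqrtRN_iff {X : Type*} [MeasurableSpace X] {μ κ : Measure X}
    [SigmaFinite μ] [SigmaFinite κ] (h : μ ≪ κ) {f : X → ℝ} (hf : AEStronglyMeasurable f μ) :
    MemLp (fun x => f x * sqrtRN μ κ x) 2 κ ↔ MemLp f 2 μ := by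
  rw [memLp_two_iff_integrable_sq (aesm_mul_sqrtRN h hf), memLp_two_iff_integrable_sq hf,
    ← integrable_rnDeriv_smul_iff h]
  refine integrable_congr (Eventually.of_forall fun x => ?_)
  have : sqrtRN μ κ x * sqrtRN μ κ x = (μ.rnDeriv κ x).toReal :=
    Real.mul_self_sqrt ENNReal.toReal_nonneg
  simp only [smul_eq_mul]
  rw [← this]; ring

theorem memLp_mul_sqrtRN {X : Type*} [MeasurableSpace X] {μ κ : Measure X}
    [SigmaFinite μ] [SigmaFinite κ] (h : μ ≪ κ) {f : X → ℝ} (hf : MemLp f 2 μ) :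
    MemLp (fun x => f x * sqrtRN μ κ x) 2 κ :=
  (memLp_mul_sqrtRN_iff h hf.1).2 hf

/-- A pair `(f, μ)`: a σ-finite measure `μ` and a real function `f ∈ L²(μ)`. -/
structure Pair (X : Type*) [MeasurableSpace X] where
  μ : Measure X
  sigmaFinite : SigmaFinite μ
  f : X → ℝ
  memLp : MemLp f 2 μ

attribute [instance] Pair.sigmaFinite

/-- `(f, μ)` and `(g, ν)` are equivalent if `f √(dμ/dκ) = g √(dν/dκ)` holds `κ`-a.e.
for some σ-finite measure `κ` with `μ ≪ κ` and `ν ≪ κ`. -/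
def Pair.Equiv {X : Type*} [MeasurableSpace X] (p q : Pair X) : Prop :=
  ∃ κ : Measure X, SigmaFinite κ ∧ p.μ ≪ κ ∧ q.μ ≪ κ ∧
    (fun x => p.f x * sqrtRN p.μ κ x) =ᵐ[κ] fun x => q.f x * sqrtRN q.μ κ x

theorem mul_sqrtRN_chain {X : Type*} [MeasurableSpace X] {μ κ κ' : Measure X}
    [SigmaFinite μ] [SigmaFinite κ] [SigmaFinite κ'] (h : μ ≪ κ) (f : X → ℝ) :
    (fun x => f x * sqrtRN μ κ x * sqrtRN κ κ' x) =ᵐ[κ'] fun x => f x * sqrtRN μ κ' x := by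
  filter_upwards [sqrtRN_chain (κ := κ') h] with x hx
  rw [mul_assoc, hx]

theorem equiv_change {X : Type*} [MeasurableSpace X] {μ ν κ κ' : Measure X}
    [SigmaFinite μ] [SigmaFinite ν] [SigmaFinite κ] [SigmaFinite κ']
    (hμ : μ ≪ κ) (hν : ν ≪ κ) (h : κ ≪ κ') (f g : X → ℝ) :
    ((fun x => f x * sqrtRN μ κ x) =ᵐ[κ] fun x => g x * sqrtRN ν κ x) ↔
      ((fun x => f x * sqrtRN μ κ' x) =ᵐ[κ'] fun x => g x * sqrtRN ν κ' x) := by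
  rw [ae_eq_iff_mul_sqrtRN h]
  constructor
  · intro H
    exact (mul_sqrtRN_chain hμ f).symm.trans (H.trans (mul_sqrtRN_chain hν g))
  · intro H
    exact (mul_sqrtRN_chain hμ f).trans (H.trans (mul_sqrtRN_chain hν g).symm)

theorem Pair.equiv_iff {X : Type*} [MeasurableSpace X] (p q : Pair X) (κ : Measure X)
    [SigmaFinite κ] (hp : p.μ ≪ κ) (hq : q.μ ≪ κ) :
    p.Equiv q ↔ (fun x => p.f x * sqrtRN p.μ κ x) =ᵐ[κ] fun x => q.f x * sqrtRN q.μ κ x := by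
  constructor
  · rintro ⟨κ', _, hp', hq', H⟩
    have h1 : κ ≪ κ + κ' := Measure.AbsolutelyContinuous.rfl.add_right _
    have h2 : κ' ≪ κ + κ' := by
      rw [add_comm]; exact Measure.AbsolutelyContinuous.rfl.add_right _
    exact (equiv_change hp hq h1 _ _).2 ((equiv_change hp' hq' h2 _ _).1 H)
  · intro H; exact ⟨κ, inferInstance, hp, hq, H⟩

theorem ac_left {X : Type*} [MeasurableSpace X] (μ ν : Measure X) : μ ≪ μ + ν :=
  Measure.AbsolutelyContinuous.rfl.add_right _

theorem ac_right {X : Type*} [MeasurableSpace X] (μ ν : Measure X) : ν ≪ μ + ν := by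
  rw [add_comm]; exact ac_left _ _

instance Pair.setoid (X : Type*) [MeasurableSpace X] : Setoid (Pair X) where
  r := Pair.Equiv
  iseqv :=
    { refl := fun p => ⟨p.μ, inferInstance, Measure.AbsolutelyContinuous.rfl,
        Measure.AbsolutelyContinuous.rfl, EventuallyEq.rfl⟩
      symm := fun ⟨κ, h, hp, hq, H⟩ => ⟨κ, h, hq, hp, H.symm⟩
      trans := fun {p q r} h1 h2 => by
        have a1 : p.μ ≪ p.μ + q.μ + r.μ := (ac_left _ _).trans (ac_left _ _)
        have a2 : q.μ ≪ p.μ + q.μ + r.μ := (ac_right _ _).trans (ac_left _ _)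
        have a3 : r.μ ≪ p.μ + q.μ + r.μ := ac_right _ _
        rw [Pair.equiv_iff _ _ _ a1 a2] at h1
        rw [Pair.equiv_iff _ _ _ a2 a3] at h2
        rw [Pair.equiv_iff _ _ _ a1 a3]
        exact h1.trans h2 }

/-- The universal Hilbert space `ℋ(X)`: the set of classes `f √dμ` of pairs `(f, μ)`. -/
def UHilbert (X : Type*) [MeasurableSpace X] : Type _ := Quotient (Pair.setoid X)

/-- The class `f √dμ` of the pair `(f, μ)`. -/
def cls {X : Type*} [MeasurableSpace X] (f : X → ℝ) (μ : Measure X) [SigmaFinite μ]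
    (hf : MemLp f 2 μ) : UHilbert X :=
  Quotient.mk (Pair.setoid X) ⟨μ, inferInstance, f, hf⟩

theorem cls_change {X : Type*} [MeasurableSpace X] {μ κ : Measure X} [SigmaFinite μ]
    [SigmaFinite κ] (h : μ ≪ κ) {f : X → ℝ} (hf : MemLp f 2 μ) :
    cls f μ hf = cls (fun x => f x * sqrtRN μ κ x) κ (memLp_mul_sqrtRN h hf) := by
  refine Quotient.sound ?_
  refine (Pair.equiv_iff _ _ κ h Measure.AbsolutelyContinuous.rfl).2 ?_
  filter_upwards [sqrtRN_self κ] with x hx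
  simp [hx]

theorem cls_eq_iff {X : Type*} [MeasurableSpace X] {μ : Measure X} [SigmaFinite μ]
    {f g : X → ℝ} (hf : MemLp f 2 μ) (hg : MemLp g 2 μ) :
    cls f μ hf = cls g μ hg ↔ f =ᵐ[μ] g := by
  refine (Quotient.eq (r := Pair.setoid X)).trans ?_
  refine (Pair.equiv_iff _ _ μ Measure.AbsolutelyContinuous.rfl
    Measure.AbsolutelyContinuous.rfl).trans ?_
  exact (ae_eq_iff_mul_sqrtRN Measure.AbsolutelyContinuous.rfl f g).symm

theorem exists_cls {X : Type*} [MeasurableSpace X] (u : UHilbert X) :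
    ∃ (μ : Measure X) (_ : SigmaFinite μ), ∀ (κ : Measure X) [SigmaFinite κ], μ ≪ κ →
      ∃ (f : X → ℝ) (hf : MemLp f 2 κ), u = cls f κ hf := by
  induction u using Quotient.inductionOn with
  | h p => exact ⟨p.μ, p.sigmaFinite, fun κ _ h => ⟨_, _, cls_change h p.memLp⟩⟩

theorem exists_cls₂ {X : Type*} [MeasurableSpace X] (u v : UHilbert X) :
    ∃ (κ : Measure X) (_ : SigmaFinite κ) (f g : X → ℝ) (hf : MemLp f 2 κ) (hg : MemLp g 2 κ),
      u = cls f κ hf ∧ v = cls g κ hg := by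
  obtain ⟨μ, _, hu⟩ := exists_cls u
  obtain ⟨ν, _, hv⟩ := exists_cls v
  obtain ⟨f, hf, rfl⟩ := hu _ (ac_left μ ν)
  obtain ⟨g, hg, rfl⟩ := hv _ (ac_right μ ν)
  exact ⟨μ + ν, inferInstance, f, g, hf, hg, rfl, rfl⟩

theorem exists_cls₃ {X : Type*} [MeasurableSpace X] (u v w : UHilbert X) :
    ∃ (κ : Measure X) (_ : SigmaFinite κ) (f g h : X → ℝ) (hf : MemLp f 2 κ) (hg : MemLp g 2 κ)
      (hh : MemLp h 2 κ), u = cls f κ hf ∧ v = cls g κ hg ∧ w = cls h κ hh := by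
  obtain ⟨μ, _, hu⟩ := exists_cls u
  obtain ⟨ν, _, hv⟩ := exists_cls v
  obtain ⟨ρ, _, hw⟩ := exists_cls w
  obtain ⟨f, hf, rfl⟩ := hu (μ + ν + ρ) ((ac_left _ _).trans (ac_left _ _))
  obtain ⟨g, hg, rfl⟩ := hv (μ + ν + ρ) ((ac_right _ _).trans (ac_left _ _))
  obtain ⟨h, hh, rfl⟩ := hw (μ + ν + ρ) (ac_right _ _)
  exact ⟨_, inferInstance, f, g, h, hf, hg, hh, rfl, rfl, rfl⟩

/-- The sum of two pairs, computed with the dominating measure `μ + ν`. -/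
def Pair.add {X : Type*} [MeasurableSpace X] (p q : Pair X) : UHilbert X :=
  cls (fun x => p.f x * sqrtRN p.μ (p.μ + q.μ) x + q.f x * sqrtRN q.μ (p.μ + q.μ) x) (p.μ + q.μ)
    ((memLp_mul_sqrtRN (ac_left _ _) p.memLp).add (memLp_mul_sqrtRN (ac_right _ _) q.memLp))

theorem Pair.add_eq {X : Type*} [MeasurableSpace X] (p q : Pair X) (κ : Measure X)
    [SigmaFinite κ] (hp : p.μ ≪ κ) (hq : q.μ ≪ κ) :
    p.add q = cls (fun x => p.f x * sqrtRN p.μ κ x + q.f x * sqrtRN q.μ κ x) κ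
      ((memLp_mul_sqrtRN hp p.memLp).add (memLp_mul_sqrtRN hq q.memLp)) := by
  have h : p.μ + q.μ ≪ κ := Measure.AbsolutelyContinuous.add_left hp hq
  rw [Pair.add, cls_change h, cls_eq_iff]
  filter_upwards [mul_sqrtRN_chain (κ' := κ) (ac_left p.μ q.μ) p.f,
    mul_sqrtRN_chain (κ' := κ) (ac_right p.μ q.μ) q.f] with x h1 h2
  rw [add_mul, h1, h2]

/-- The inner product of two pairs, computed with the dominating measure `μ + ν`. -/
def Pair.inner {X : Type*} [MeasurableSpace X] (p q : Pair X) : ℝ :=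
  ∫ x, p.f x * q.f x * sqrtRN p.μ (p.μ + q.μ) x * sqrtRN q.μ (p.μ + q.μ) x ∂(p.μ + q.μ)

theorem Pair.inner_eq {X : Type*} [MeasurableSpace X] (p q : Pair X) (κ : Measure X)
    [SigmaFinite κ] (hp : p.μ ≪ κ) (hq : q.μ ≪ κ) :
    p.inner q = ∫ x, (p.f x * sqrtRN p.μ κ x) * (q.f x * sqrtRN q.μ κ x) ∂κ := by
  have h : p.μ + q.μ ≪ κ := Measure.AbsolutelyContinuous.add_left hp hq
  have e : p.inner q = ∫ x, (p.f x * sqrtRN p.μ (p.μ + q.μ) x) *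
      (q.f x * sqrtRN q.μ (p.μ + q.μ) x) ∂(p.μ + q.μ) := by
    unfold Pair.inner
    congr 1; ext x; ring
  rw [e, ← integral_mul_sqrtRN h]
  refine integral_congr_ae ?_
  filter_upwards [mul_sqrtRN_chain (κ' := κ) (ac_left p.μ q.μ) p.f,
    mul_sqrtRN_chain (κ' := κ) (ac_right p.μ q.μ) q.f] with x h1 h2
  rw [h1, h2]

theorem Pair.common {X : Type*} [MeasurableSpace X] {p q p' q' : Pair X} (hp : p.Equiv p')
    (hq : q.Equiv q') : ∃ (κ : Measure X) (_ : SigmaFinite κ), p.μ ≪ κ ∧ q.μ ≪ κ ∧ p'.μ ≪ κ ∧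
      q'.μ ≪ κ ∧
      ((fun x => p.f x * sqrtRN p.μ κ x) =ᵐ[κ] fun x => p'.f x * sqrtRN p'.μ κ x) ∧
      ((fun x => q.f x * sqrtRN q.μ κ x) =ᵐ[κ] fun x => q'.f x * sqrtRN q'.μ κ x) := by
  have a1 : p.μ ≪ (p.μ + q.μ) + (p'.μ + q'.μ) := (ac_left _ _).trans (ac_left _ _)
  have a2 : q.μ ≪ (p.μ + q.μ) + (p'.μ + q'.μ) := (ac_right _ _).trans (ac_left _ _)
  have a3 : p'.μ ≪ (p.μ + q.μ) + (p'.μ + q'.μ) := (ac_left _ _).trans (ac_right _ _)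
  have a4 : q'.μ ≪ (p.μ + q.μ) + (p'.μ + q'.μ) := (ac_right _ _).trans (ac_right _ _)
  exact ⟨_, inferInstance, a1, a2, a3, a4, (Pair.equiv_iff _ _ _ a1 a3).1 hp,
    (Pair.equiv_iff _ _ _ a2 a4).1 hq⟩

instance {X : Type*} [MeasurableSpace X] : Add (UHilbert X) where
  add := Quotient.lift₂ Pair.add (by
    intro p q p' q' hp hq
    obtain ⟨κ, _, a1, a2, a3, a4, e1, e2⟩ := Pair.common hp hq
    rw [Pair.add_eq p q κ a1 a2, Pair.add_eq p' q' κ a3 a4, cls_eq_iff]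
    filter_upwards [e1, e2] with x h1 h2
    rw [h1, h2])

instance {X : Type*} [MeasurableSpace X] : Inner ℝ (UHilbert X) where
  inner := Quotient.lift₂ Pair.inner (by
    intro p q p' q' hp hq
    obtain ⟨κ, _, a1, a2, a3, a4, e1, e2⟩ := Pair.common hp hq
    rw [Pair.inner_eq p q κ a1 a2, Pair.inner_eq p' q' κ a3 a4]
    refine integral_congr_ae ?_
    filter_upwards [e1, e2] with x h1 h2
    rw [h1, h2])

instance {X : Type*} [MeasurableSpace X] : SMul ℝ (UHilbert X) where
  smul c := Quotient.lift (fun p : Pair X => cls (fun x => c * p.f x) p.μ (p.memLp.const_mul c)) (by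
    intro p q hp
    have a1 := ac_left p.μ q.μ
    have a2 := ac_right p.μ q.μ
    have e := (Pair.equiv_iff _ _ _ a1 a2).1 hp
    rw [cls_change a1, cls_change a2, cls_eq_iff]
    filter_upwards [e] with x h
    rw [mul_assoc, h, mul_assoc])

instance {X : Type*} [MeasurableSpace X] : Zero (UHilbert X) where
  zero := cls (fun _ => 0) 0 MemLp.zero'

instance {X : Type*} [MeasurableSpace X] : Neg (UHilbert X) where
  neg u := (-1 : ℝ) • u

theorem cls_add {X : Type*} [MeasurableSpace X] {μ : Measure X} [SigmaFinite μ]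
    {f g : X → ℝ} (hf : MemLp f 2 μ) (hg : MemLp g 2 μ) :
    cls f μ hf + cls g μ hg = cls (fun x => f x + g x) μ (hf.add hg) := by
  refine (Pair.add_eq ⟨μ, inferInstance, f, hf⟩ ⟨μ, inferInstance, g, hg⟩ μ
    Measure.AbsolutelyContinuous.rfl Measure.AbsolutelyContinuous.rfl).trans ?_
  rw [cls_eq_iff]
  filter_upwards [sqrtRN_self μ] with x hx
  simp [hx]

theorem cls_smul {X : Type*} [MeasurableSpace X] {μ : Measure X} [SigmaFinite μ] (c : ℝ)
    {f : X → ℝ} (hf : MemLp f 2 μ) :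
    c • cls f μ hf = cls (fun x => c * f x) μ (hf.const_mul c) := rfl

theorem cls_neg {X : Type*} [MeasurableSpace X] {μ : Measure X} [SigmaFinite μ]
    {f : X → ℝ} (hf : MemLp f 2 μ) :
    -cls f μ hf = cls (fun x => (-1) * f x) μ (hf.const_mul (-1)) := rfl

theorem zero_eq_cls {X : Type*} [MeasurableSpace X] (μ : Measure X) [SigmaFinite μ] :
    (0 : UHilbert X) = cls (fun _ => 0) μ MemLp.zero' := by
  refine (cls_change (Measure.AbsolutelyContinuous.zero μ) MemLp.zero').trans ?_
  rw [cls_eq_iff]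
  simp

theorem cls_inner {X : Type*} [MeasurableSpace X] {μ : Measure X} [SigmaFinite μ]
    {f g : X → ℝ} (hf : MemLp f 2 μ) (hg : MemLp g 2 μ) :
    inner ℝ (cls f μ hf) (cls g μ hg) = ∫ x, f x * g x ∂μ := by
  refine (Pair.inner_eq ⟨μ, inferInstance, f, hf⟩ ⟨μ, inferInstance, g, hg⟩ μ
    Measure.AbsolutelyContinuous.rfl Measure.AbsolutelyContinuous.rfl).trans ?_
  exact integral_mul_sqrtRN Measure.AbsolutelyContinuous.rfl f g

instance {X : Type*} [MeasurableSpace X] : AddCommGroup (UHilbert X) where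
  add_assoc u v w := by
    obtain ⟨κ, _, f, g, h, hf, hg, hh, rfl, rfl, rfl⟩ := exists_cls₃ u v w
    simp only [cls_add, add_assoc]
  zero_add u := by
    obtain ⟨κ, _, f, g, hf, hg, rfl, -⟩ := exists_cls₂ u u
    rw [zero_eq_cls κ, cls_add]; simp only [zero_add]
  add_zero u := by
    obtain ⟨κ, _, f, g, hf, hg, rfl, -⟩ := exists_cls₂ u u
    rw [zero_eq_cls κ, cls_add]; simp only [add_zero]
  nsmul := nsmulRec
  zsmul := zsmulRec
  neg_add_cancel u := by
    obtain ⟨κ, _, f, g, hf, hg, rfl, -⟩ := exists_cls₂ u u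
    rw [zero_eq_cls κ, cls_neg, cls_add, cls_eq_iff]
    exact Eventually.of_forall fun x => by ring
  add_comm u v := by
    obtain ⟨κ, _, f, g, hf, hg, rfl, rfl⟩ := exists_cls₂ u v
    simp only [cls_add, add_comm]

instance {X : Type*} [MeasurableSpace X] : Module ℝ (UHilbert X) where
  one_smul u := by
    obtain ⟨κ, _, f, g, hf, hg, rfl, -⟩ := exists_cls₂ u u
    simp only [cls_smul, one_mul]
  mul_smul a b u := by
    obtain ⟨κ, _, f, g, hf, hg, rfl, -⟩ := exists_cls₂ u u
    simp only [cls_smul, mul_assoc]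
  smul_zero a := by
    rw [zero_eq_cls 0]; simp only [cls_smul, mul_zero]
  smul_add a u v := by
    obtain ⟨κ, _, f, g, hf, hg, rfl, rfl⟩ := exists_cls₂ u v
    simp only [cls_add, cls_smul, mul_add]
  add_smul a b u := by
    obtain ⟨κ, _, f, g, hf, hg, rfl, -⟩ := exists_cls₂ u u
    simp only [cls_add, cls_smul, add_mul]
  zero_smul u := by
    obtain ⟨κ, _, f, g, hf, hg, rfl, -⟩ := exists_cls₂ u u
    rw [zero_eq_cls κ]; simp only [cls_smul, zero_mul]

abbrev innerCore (X : Type*) [MeasurableSpace X] : InnerProductSpace.Core ℝ (UHilbert X) where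
  toInner := inferInstance
  conj_inner_symm u v := by
    obtain ⟨κ, _, f, g, hf, hg, rfl, rfl⟩ := exists_cls₂ u v
    simp only [cls_inner, mul_comm, conj_trivial]
  re_inner_nonneg u := by
    obtain ⟨κ, _, f, g, hf, hg, rfl, -⟩ := exists_cls₂ u u
    rw [cls_inner]
    exact integral_nonneg fun x => mul_self_nonneg (f x)
  add_left u v w := by
    obtain ⟨κ, _, f, g, h, hf, hg, hh, rfl, rfl, rfl⟩ := exists_cls₃ u v w
    simp only [cls_add, cls_inner, add_mul]
    exact integral_add (hf.integrable_mul hh) (hg.integrable_mul hh)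
  smul_left u v r := by
    obtain ⟨κ, _, f, g, hf, hg, rfl, rfl⟩ := exists_cls₂ u v
    simp only [cls_smul, cls_inner, mul_assoc, conj_trivial]
    exact integral_const_mul _ _
  definite u hu := by
    obtain ⟨κ, _, f, g, hf, hg, rfl, -⟩ := exists_cls₂ u u
    rw [cls_inner, integral_eq_zero_iff_of_nonneg (fun x => mul_self_nonneg (f x))
      (hf.integrable_mul hf)] at hu
    rw [zero_eq_cls κ, cls_eq_iff]
    filter_upwards [hu] with x hx
    simpa using hx

instance {X : Type*} [MeasurableSpace X] : NormedAddCommGroup (UHilbert X) :=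
  @InnerProductSpace.Core.toNormedAddCommGroup ℝ (UHilbert X) _ _ _ (innerCore X)

instance {X : Type*} [MeasurableSpace X] : InnerProductSpace ℝ (UHilbert X) :=
  InnerProductSpace.ofCore (innerCore X).toCore

/-- The isometric embedding `ι : f ↦ f √dμ` of `L²(μ)` into `ℋ(X)`. -/
def iota {X : Type*} [MeasurableSpace X] (μ : Measure X) [SigmaFinite μ] :
    Lp ℝ 2 μ →ₗᵢ[ℝ] UHilbert X where
  toFun f := cls f μ (Lp.memLp f)
  map_add' f g := by
    rw [cls_add, cls_eq_iff]
    exact Lp.coeFn_add f g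
  map_smul' c f := by
    rw [RingHom.id_apply, cls_smul, cls_eq_iff]
    exact Lp.coeFn_smul c f
  norm_map' f := by
    have h : inner ℝ (cls f μ (Lp.memLp f)) (cls f μ (Lp.memLp f)) = inner ℝ f f := by
      rw [cls_inner, L2.inner_def]
      rfl
    rw [real_inner_self_eq_norm_sq, real_inner_self_eq_norm_sq] at h
    exact (sq_eq_sq₀ (norm_nonneg _) (norm_nonneg _)).1 h

/-- The subspace `ℋ(μ) = ι(L²(μ))` of `ℋ(X)`. -/
def subspaceOf {X : Type*} [MeasurableSpace X] (μ : Measure X) [SigmaFinite μ] : Submodule ℝ (UHilbert X) :=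
  LinearMap.range (iota μ).toLinearMap

theorem cls_mem_subspaceOf {X : Type*} [MeasurableSpace X] {μ : Measure X} [SigmaFinite μ]
    {f : X → ℝ} (hf : MemLp f 2 μ) : cls f μ hf ∈ subspaceOf μ :=
  ⟨hf.toLp f, (cls_eq_iff _ hf).2 hf.coeFn_toLp⟩

instance {X : Type*} [MeasurableSpace X] : CompleteSpace (UHilbert X) := by
  refine Metric.complete_of_cauchySeq_tendsto fun u hu => ?_
  choose μ hμ h using fun n => exists_cls (u n)
  let κ : Measure X := (Measure.sum μ).toFinite
  have hk : ∀ n, ∃ f : Lp ℝ 2 κ, iota κ f = u n := fun n => by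
    obtain ⟨f, hf, e⟩ := h n κ ((Measure.absolutelyContinuous_sum_right n
      Measure.AbsolutelyContinuous.rfl).trans (absolutelyContinuous_toFinite _))
    rw [e]; exact cls_mem_subspaceOf hf
  choose f hf using hk
  have hc : CauchySeq f := by
    rw [Metric.cauchySeq_iff] at hu ⊢
    intro ε hε
    obtain ⟨N, hN⟩ := hu ε hε
    refine ⟨N, fun m hm n hn => ?_⟩
    rw [← (iota κ).dist_map, hf, hf]
    exact hN m hm n hn
  obtain ⟨g, hg⟩ := cauchySeq_tendsto_of_complete hc
  refine ⟨iota κ g, ?_⟩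
  have := ((iota κ).continuous.tendsto g).comp hg
  convert this using 1
  exact (funext hf).symm

/-- A sequence `f` of functions order converges to `0` in the space `E` of functions: there are
`h n ∈ E` decreasing to `0` with `|f n| ≤ h n` for all large `n`. (In the spaces used below the
infimum of a decreasing sequence in `E` that is bounded below by `0` is the pointwise one.) -/
def OrderNull {X : Type*} (E : Submodule ℝ (X → ℝ)) (f : ℕ → X → ℝ) : Prop :=
  ∃ h : ℕ → X → ℝ, (∀ n, h n ∈ E) ∧ Antitone h ∧
    (∀ x, Tendsto (fun n => h n x) atTop (𝓝 0)) ∧ ∀ᶠ n in atTop, ∀ x, |f n x| ≤ h n x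

/-- The space `𝓕(X)` of all real-valued Borel functions. -/
def borelFun (X : Type*) [MeasurableSpace X] : Submodule ℝ (X → ℝ) where
  carrier := {f | Measurable f}
  add_mem' hf hg := Measurable.add hf hg
  zero_mem' := measurable_const
  smul_mem' c _ hf := Measurable.const_mul hf c

/-- An order continuous transfer operator `(R, σ)`. Its domain `dom` is a space of Borel functions
that contains the constants and, with `f`, all Borel `g` with `|g| ≤ |f|`: for instance
the space of all Borel functions, or the space of all bounded ones. -/
structure TransferOperator (X : Type*) [MeasurableSpace X] where
  /-- the surjective Borel endomorphism -/
  σ : X → X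
  measurable_σ : Measurable σ
  surjective_σ : Function.Surjective σ
  /-- the space of functions on which `R` acts -/
  dom : Submodule ℝ (X → ℝ)
  dom_le : dom ≤ borelFun X
  one_mem : (1 : X → ℝ) ∈ dom
  solid : ∀ f ∈ dom, ∀ g ∈ borelFun X, (∀ x, |g x| ≤ |f x|) → g ∈ dom
  /-- the operator -/
  R : dom →ₗ[ℝ] borelFun X
  /-- `R` is positive -/
  nonneg : ∀ f : dom, (∀ x, 0 ≤ f.1 x) → ∀ x, 0 ≤ (R f).1 x
  /-- the pull-out property `R ((f ∘ σ) g) = f R(g)` -/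
  pull_out : ∀ f ∈ borelFun X, ∀ (g : dom) (h : (f ∘ σ) * g.1 ∈ dom),
    (R ⟨(f ∘ σ) * g.1, h⟩).1 = f * (R g).1
  /-- `R` is order continuous -/
  order_cont : ∀ f : ℕ → dom, OrderNull dom (fun n => (f n).1) →
    OrderNull (borelFun X) (fun n => (R (f n)).1)

namespace TransferOperator

/-- The constant function `1`, as an element of the domain of `R`. -/
def one {X : Type*} [MeasurableSpace X] (T : TransferOperator X) : T.dom := ⟨1, T.one_mem⟩

/-- The characteristic function of a Borel set, as an element of the domain of `R`. -/
def chi {X : Type*} [MeasurableSpace X] (T : TransferOperator X) (A : Set X)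
    (hA : MeasurableSet A) : T.dom :=
  ⟨A.indicator 1, T.solid 1 T.one_mem _ (measurable_one.indicator hA) fun x => by
    by_cases h : x ∈ A <;> simp [h]⟩

theorem chi_val {X : Type*} [MeasurableSpace X] (T : TransferOperator X) {A : Set X}
    (hA : MeasurableSet A) : (T.chi A hA).1 = A.indicator 1 := rfl

theorem R_chi_nonneg {X : Type*} [MeasurableSpace X] (T : TransferOperator X) {A : Set X}
    (hA : MeasurableSet A) (x : X) : 0 ≤ (T.R (T.chi A hA)).1 x :=
  T.nonneg _ (fun y => by rw [chi_val]; exact Set.indicator_nonneg (fun _ _ => zero_le_one) y) x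

theorem R_chi_union {X : Type*} [MeasurableSpace X] (T : TransferOperator X) {A B : Set X}
    (hA : MeasurableSet A) (hB : MeasurableSet B) (h : Disjoint A B) :
    T.R (T.chi (A ∪ B) (hA.union hB)) = T.R (T.chi A hA) + T.R (T.chi B hB) := by
  rw [← map_add]
  congr 1
  apply Subtype.ext
  change (A ∪ B).indicator (1 : X → ℝ) = A.indicator 1 + B.indicator 1
  exact Set.indicator_union_of_disjoint h 1

theorem R_chi_iUnion {X : Type*} [MeasurableSpace X] (T : TransferOperator X) {A : ℕ → Set X}
    (hA : ∀ i, MeasurableSet (A i)) (hd : Pairwise (Function.onFun Disjoint A)) (x : X) :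
    ENNReal.ofReal ((T.R (T.chi (⋃ i, A i) (MeasurableSet.iUnion hA))).1 x) =
      ∑' i, ENNReal.ofReal ((T.R (T.chi (A i) (hA i))).1 x) := by
  let U : ℕ → Set X := fun n => ⋃ i ∈ Finset.range n, A i
  have hU : ∀ n, MeasurableSet (U n) := fun n => Finset.measurableSet_biUnion _ fun i _ => hA i
  let V : ℕ → Set X := fun n => (⋃ i, A i) \ U n
  have hV : ∀ n, MeasurableSet (V n) := fun n => (MeasurableSet.iUnion hA).diff (hU n)
  have hUV : ∀ n, U n ∪ V n = ⋃ i, A i := fun n =>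
    Set.union_sdiff_cancel (Set.iUnion₂_subset fun i _ => Set.subset_iUnion A i)
  have e1 : ∀ n, (T.R (T.chi (⋃ i, A i) (MeasurableSet.iUnion hA))).1 x =
      (T.R (T.chi (U n) (hU n))).1 x + (T.R (T.chi (V n) (hV n))).1 x := fun n => by
    have := T.R_chi_union (hU n) (hV n) Set.disjoint_sdiff_right
    simp only [hUV n] at this
    rw [this]; rfl
  have e2 : ∀ n, (T.R (T.chi (U n) (hU n))).1 x =
      ∑ i ∈ Finset.range n, (T.R (T.chi (A i) (hA i))).1 x := by
    intro n
    induction n with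
    | zero =>
      have : T.chi (U 0) (hU 0) = 0 := by
        apply Subtype.ext
        rw [chi_val]
        simp only [U, Finset.range_zero, Finset.notMem_empty, Set.iUnion_of_empty, Set.iUnion_empty,
          Set.indicator_empty']
        rfl
      rw [this, map_zero]; simp
    | succ n ih =>
      have hn : U (n + 1) = U n ∪ A n := by
        simp only [U, Finset.range_add_one, Finset.set_biUnion_insert]
        exact Set.union_comm _ _
      have hdis : Disjoint (U n) (A n) := by
        simp only [U, Set.disjoint_iUnion_left]
        intro i hi
        exact hd (Finset.mem_range.1 hi).ne
      have := T.R_chi_union (hU n) (hA n) hdis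
      simp only [← hn] at this
      rw [this, Finset.sum_range_succ, ← ih]; rfl
  have hVnull : Tendsto (fun n => (T.R (T.chi (V n) (hV n))).1 x) atTop (𝓝 0) := by
    obtain ⟨h, -, -, h0, hb⟩ := T.order_cont (fun n => T.chi (V n) (hV n))
      ⟨fun n => (V n).indicator 1, fun n => (T.chi (V n) (hV n)).2, by
        intro m n hmn y
        refine Set.indicator_le_indicator_of_subset ?_ (fun _ => zero_le_one) y
        refine Set.sdiff_subset_sdiff_right ?_
        exact Set.biUnion_subset_biUnion_left fun i hi =>
          Finset.mem_range.2 ((Finset.mem_range.1 hi).trans_le hmn), by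
        intro y
        refine tendsto_const_nhds.congr' ?_
        by_cases hy : ∃ i, y ∈ A i
        · obtain ⟨i, hi⟩ := hy
          filter_upwards [eventually_gt_atTop i] with n hn
          have : y ∉ V n := fun hy => hy.2 (Set.mem_biUnion (Finset.mem_range.2 hn) hi)
          simp [this]
        · refine Eventually.of_forall fun n => ?_
          have : y ∉ V n := fun h => hy (Set.mem_iUnion.1 h.1)
          simp [this],
        Eventually.of_forall fun n y => by
          exact (abs_of_nonneg (Set.indicator_nonneg (fun _ _ => zero_le_one) y)).le⟩
    refine squeeze_zero_norm' ?_ (h0 x)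
    filter_upwards [hb] with n hn using hn x
  have hlim : Tendsto (fun n => ENNReal.ofReal (∑ i ∈ Finset.range n,
      (T.R (T.chi (A i) (hA i))).1 x)) atTop
      (𝓝 (ENNReal.ofReal ((T.R (T.chi (⋃ i, A i) (MeasurableSet.iUnion hA))).1 x))) := by
    refine (ENNReal.continuous_ofReal.tendsto _).comp ?_
    have : Tendsto (fun n => (T.R (T.chi (⋃ i, A i) (MeasurableSet.iUnion hA))).1 x -
        (T.R (T.chi (V n) (hV n))).1 x) atTop
        (𝓝 ((T.R (T.chi (⋃ i, A i) (MeasurableSet.iUnion hA))).1 x - 0)) :=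
      tendsto_const_nhds.sub hVnull
    rw [sub_zero] at this
    refine this.congr fun n => ?_
    rw [← e2, e1 n]; ring
  refine tendsto_nhds_unique hlim ?_
  have := ENNReal.tendsto_nat_tsum fun i => ENNReal.ofReal ((T.R (T.chi (A i) (hA i))).1 x)
  refine this.congr fun n => ?_
  rw [ENNReal.ofReal_sum_of_nonneg fun i _ => T.R_chi_nonneg (hA i) x]

theorem R_chi_empty {X : Type*} [MeasurableSpace X] (T : TransferOperator X) (x : X) :
    ENNReal.ofReal ((T.R (T.chi ∅ MeasurableSet.empty)).1 x) = 0 := by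
  have : T.chi ∅ MeasurableSet.empty = 0 := by
    apply Subtype.ext
    rw [chi_val, Set.indicator_empty']
    rfl
  rw [this, map_zero]
  simp

theorem measurable_R_chi {X : Type*} [MeasurableSpace X] (T : TransferOperator X) {A : Set X}
    (hA : MeasurableSet A) : Measurable fun x => ENNReal.ofReal ((T.R (T.chi A hA)).1 x) :=
  (show Measurable (T.R (T.chi A hA)).1 from (T.R (T.chi A hA)).2).ennreal_ofReal

/-- The measure `μR`, given by `(μR)(A) = ∫ R(χ_A) dμ`. -/
def act {X : Type*} [MeasurableSpace X] (T : TransferOperator X) (μ : Measure X) : Measure X :=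
  Measure.ofMeasurable (fun A hA => ∫⁻ x, ENNReal.ofReal ((T.R (T.chi A hA)).1 x) ∂μ)
    (by simp only [T.R_chi_empty]; simp)
    (fun A hA hd => by
      simp only [T.R_chi_iUnion hA hd]
      exact lintegral_tsum fun i => (T.measurable_R_chi (hA i)).aemeasurable)

/-- The finite measure `A ↦ R(χ_A)(x)`. -/
def ker {X : Type*} [MeasurableSpace X] (T : TransferOperator X) (x : X) : Measure X :=
  Measure.ofMeasurable (fun A hA => ENNReal.ofReal ((T.R (T.chi A hA)).1 x))
    (T.R_chi_empty x) (fun _ hA hd => T.R_chi_iUnion hA hd x)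

theorem ker_apply {X : Type*} [MeasurableSpace X] (T : TransferOperator X) (x : X) {A : Set X}
    (hA : MeasurableSet A) : T.ker x A = ENNReal.ofReal ((T.R (T.chi A hA)).1 x) :=
  Measure.ofMeasurable_apply A hA

theorem act_apply {X : Type*} [MeasurableSpace X] (T : TransferOperator X) (μ : Measure X)
    {A : Set X} (hA : MeasurableSet A) :
    T.act μ A = ∫⁻ x, ENNReal.ofReal ((T.R (T.chi A hA)).1 x) ∂μ :=
  Measure.ofMeasurable_apply A hA

theorem measurable_ker {X : Type*} [MeasurableSpace X] (T : TransferOperator X) :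
    Measurable T.ker :=
  Measure.measurable_of_measurable_coe _ fun A hA => by
    simp only [T.ker_apply _ hA]; exact T.measurable_R_chi hA

theorem act_eq_bind {X : Type*} [MeasurableSpace X] (T : TransferOperator X) (μ : Measure X) :
    T.act μ = μ.bind T.ker := by
  ext A hA
  rw [T.act_apply μ hA, Measure.bind_apply hA T.measurable_ker.aemeasurable]
  simp only [T.ker_apply _ hA]

theorem lintegral_act {X : Type*} [MeasurableSpace X] (T : TransferOperator X) (μ : Measure X)
    {g : X → ℝ≥0∞} (hg : Measurable g) :
    ∫⁻ y, g y ∂(T.act μ) = ∫⁻ x, ∫⁻ y, g y ∂(T.ker x) ∂μ := by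
  rw [act_eq_bind, Measure.lintegral_bind T.measurable_ker.aemeasurable hg.aemeasurable]

theorem ae_ker {X : Type*} [MeasurableSpace X] [MeasurableSingletonClass X]
    (T : TransferOperator X) (x : X) : ∀ᵐ y ∂(T.ker x), T.σ y = x := by
  have hB : MeasurableSet ({x}ᶜ : Set X) := (measurableSet_singleton x).compl
  have hA : MeasurableSet (T.σ ⁻¹' {x}ᶜ) := T.measurable_σ hB
  have e : ((({x}ᶜ : Set X).indicator (1 : X → ℝ)) ∘ T.σ) * T.one.1 =
      (T.chi (T.σ ⁻¹' {x}ᶜ) hA).1 := by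
    ext y
    rw [chi_val]
    simp only [one, mul_one]
    rfl
  have h := T.pull_out (({x}ᶜ : Set X).indicator 1) (measurable_one.indicator hB) T.one
    (by rw [e]; exact (T.chi _ hA).2)
  have h2 : (T.R (T.chi (T.σ ⁻¹' {x}ᶜ) hA)).1 x = 0 := by
    have : T.chi (T.σ ⁻¹' {x}ᶜ) hA =
        ⟨((({x}ᶜ : Set X).indicator (1 : X → ℝ)) ∘ T.σ) * T.one.1,
          by rw [e]; exact (T.chi _ hA).2⟩ := Subtype.ext e.symm
    rw [this, h]
    simp
  have h3 : T.ker x (T.σ ⁻¹' {x}ᶜ) = 0 := by rw [T.ker_apply x hA, h2, ENNReal.ofReal_zero]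
  exact h3

theorem lintegral_act_mul {X : Type*} [MeasurableSpace X] [MeasurableSingletonClass X]
    (T : TransferOperator X) (μ : Measure X)
    {φ g : X → ℝ≥0∞} (hφ : Measurable φ) (hg : Measurable g) :
    ∫⁻ y, φ (T.σ y) * g y ∂(T.act μ) = ∫⁻ x, φ x * ∫⁻ y, g y ∂(T.ker x) ∂μ := by
  refine (T.lintegral_act μ ((hφ.comp T.measurable_σ).mul hg)).trans ?_
  refine lintegral_congr fun x => ?_
  rw [← lintegral_const_mul _ hg]
  refine lintegral_congr_ae ?_
  filter_upwards [T.ae_ker x] with y hy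
  simp only [Pi.mul_apply, Function.comp_apply, hy]

theorem act_withDensity {X : Type*} [MeasurableSpace X] [MeasurableSingletonClass X]
    (T : TransferOperator X) (μ : Measure X) {φ : X → ℝ≥0∞} (hφ : Measurable φ) :
    T.act (μ.withDensity φ) = (T.act μ).withDensity (φ ∘ T.σ) := by
  ext A hA
  have hk : Measurable fun x => T.ker x A := (Measure.measurable_coe hA).comp T.measurable_ker
  have h := T.lintegral_act_mul μ hφ (measurable_one.indicator hA : Measurable (A.indicator 1))
  simp only [lintegral_indicator_one hA] at h
  rw [withDensity_apply _ hA, act_eq_bind, Measure.bind_apply hA T.measurable_ker.aemeasurable,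
    lintegral_withDensity_eq_lintegral_mul _ hφ hk]
  refine h.symm.trans ?_
  rw [← lintegral_indicator hA]
  refine lintegral_congr fun y => ?_
  by_cases hy : y ∈ A <;> simp [hy]

theorem quasi {X : Type*} [MeasurableSpace X] [MeasurableSingletonClass X]
    (T : TransferOperator X) (μ : Measure X) :
    Measure.QuasiMeasurePreserving T.σ (T.act μ) μ := by
  refine ⟨T.measurable_σ, Measure.AbsolutelyContinuous.mk fun B hB h0 => ?_⟩
  rw [Measure.map_apply T.measurable_σ hB]
  have h := T.lintegral_act_mul μ (φ := B.indicator 1) (g := fun _ => 1)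
    (measurable_one.indicator hB) measurable_const
  have e : ∫⁻ y, (B.indicator 1 (T.σ y) : ℝ≥0∞) * 1 ∂(T.act μ) = T.act μ (T.σ ⁻¹' B) := by
    rw [← lintegral_indicator_one (T.measurable_σ hB)]
    refine lintegral_congr fun y => ?_
    rw [mul_one]; rfl
  rw [← e, h]
  refine (lintegral_congr_ae (g := fun _ => 0) ?_).trans (by simp)
  filter_upwards [measure_eq_zero_iff_ae_notMem.1 h0] with x hx
  simp [hx]

theorem act_mono_ac {X : Type*} [MeasurableSpace X] (T : TransferOperator X) {μ ν : Measure X}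
    (h : μ ≪ ν) : T.act μ ≪ T.act ν := by
  refine Measure.AbsolutelyContinuous.mk fun A hA h0 => ?_
  rw [T.act_apply _ hA] at h0 ⊢
  rw [lintegral_eq_zero_iff (T.measurable_R_chi hA)] at h0 ⊢
  exact h.ae_le h0

instance {X : Type*} [MeasurableSpace X] [MeasurableSingletonClass X]
    (T : TransferOperator X) (μ : Measure X) [SigmaFinite μ] : SigmaFinite (T.act μ) := by
  have hm : Measurable (T.R T.one).1 := (T.R T.one).2
  let B : ℕ → Set X := fun n => {x | (T.R T.one).1 x ≤ n} ∩ spanningSets μ n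
  have hB : ∀ n, MeasurableSet (B n) := fun n =>
    (measurableSet_le hm measurable_const).inter (measurableSet_spanningSets μ n)
  refine ⟨⟨⟨fun n => T.σ ⁻¹' (B n), fun _ => trivial, fun n => ?_, ?_⟩⟩⟩
  · have h := T.lintegral_act_mul μ (φ := (B n).indicator 1) (g := fun _ => 1)
      (measurable_one.indicator (hB n)) measurable_const
    have e : ∫⁻ y, ((B n).indicator 1 (T.σ y) : ℝ≥0∞) * 1 ∂(T.act μ) =
        T.act μ (T.σ ⁻¹' (B n)) := by
      rw [← lintegral_indicator_one (T.measurable_σ (hB n))]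
      refine lintegral_congr fun y => ?_
      rw [mul_one]; rfl
    have hu : T.chi Set.univ MeasurableSet.univ = T.one :=
      Subtype.ext (by rw [chi_val]; simp [one])
    rw [← e, h]
    calc ∫⁻ x, (B n).indicator 1 x * ∫⁻ _, 1 ∂(T.ker x) ∂μ
        ≤ ∫⁻ x, (spanningSets μ n).indicator (fun _ => (n : ℝ≥0∞)) x ∂μ := by
          refine lintegral_mono fun x => ?_
          by_cases hx : x ∈ B n
          · simp only [Set.indicator_of_mem hx, Set.indicator_of_mem hx.2, Pi.one_apply, one_mul,
              lintegral_const]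
            rw [T.ker_apply x MeasurableSet.univ, hu]
            exact ENNReal.ofReal_le_of_le_toReal (by simpa using hx.1)
          · simp [hx]
      _ < ∞ := by
          rw [lintegral_indicator_const (measurableSet_spanningSets μ n)]
          exact ENNReal.mul_lt_top (ENNReal.natCast_lt_top n) (measure_spanningSets_lt_top μ n)
  · rw [← Set.preimage_iUnion, ← Set.preimage_univ (f := T.σ)]
    congr 1
    refine Set.eq_univ_of_forall fun x => ?_
    obtain ⟨m, hm⟩ := exists_nat_ge ((T.R T.one).1 x)
    have hx : x ∈ ⋃ n, spanningSets μ n := by rw [iUnion_spanningSets]; trivial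
    obtain ⟨k, hk⟩ := Set.mem_iUnion.1 hx
    refine Set.mem_iUnion.2 ⟨max m k, ?_, monotone_spanningSets μ (le_max_right m k) hk⟩
    exact hm.trans (by exact_mod_cast le_max_left m k)

theorem sqrtRN_act {X : Type*} [MeasurableSpace X] [MeasurableSingletonClass X]
    (T : TransferOperator X) {μ κ : Measure X} [SigmaFinite μ] [SigmaFinite κ] (h : μ ≪ κ) :
    sqrtRN (T.act μ) (T.act κ) =ᵐ[T.act κ] fun x => sqrtRN μ κ (T.σ x) := by
  have e := T.act_withDensity κ (Measure.measurable_rnDeriv μ κ)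
  rw [Measure.withDensity_rnDeriv_eq _ _ h] at e
  have h2 := Measure.rnDeriv_withDensity (T.act κ)
    ((Measure.measurable_rnDeriv μ κ).comp T.measurable_σ)
  rw [← e] at h2
  filter_upwards [h2] with x hx
  simp [sqrtRN, hx]

/-- `v = (f ∘ σ) √d(μR)` for a representation `u = f √dμ` with `f ∘ σ ∈ L²(μR)`. -/
def HatRel {X : Type*} [MeasurableSpace X] [MeasurableSingletonClass X]
    (T : TransferOperator X) (u v : UHilbert X) : Prop :=
  ∃ (μ : Measure X) (_ : SigmaFinite μ) (f : X → ℝ) (hf : MemLp f 2 μ)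
    (hσ : MemLp (f ∘ T.σ) 2 (T.act μ)), u = cls f μ hf ∧ v = cls (f ∘ T.σ) (T.act μ) hσ

theorem act_mul_ae {X : Type*} [MeasurableSpace X] [MeasurableSingletonClass X]
    (T : TransferOperator X) {μ κ : Measure X} [SigmaFinite μ] [SigmaFinite κ] (h : μ ≪ κ)
    (f : X → ℝ) : (fun x => (f ∘ T.σ) x * sqrtRN (T.act μ) (T.act κ) x) =ᵐ[T.act κ]
      (fun x => f x * sqrtRN μ κ x) ∘ T.σ := by
  filter_upwards [T.sqrtRN_act h] with x hx
  simp [hx]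

theorem memLp_act_change {X : Type*} [MeasurableSpace X] [MeasurableSingletonClass X]
    (T : TransferOperator X) {μ κ : Measure X} [SigmaFinite μ] [SigmaFinite κ] (h : μ ≪ κ)
    {f : X → ℝ} (hf : MemLp f 2 μ) :
    MemLp ((fun x => f x * sqrtRN μ κ x) ∘ T.σ) 2 (T.act κ) ↔
      MemLp (f ∘ T.σ) 2 (T.act μ) := by
  rw [← memLp_mul_sqrtRN_iff (T.act_mono_ac h) (hf.1.comp_quasiMeasurePreserving (T.quasi μ))]
  exact memLp_congr_ae (T.act_mul_ae h f).symm

theorem cls_act_change {X : Type*} [MeasurableSpace X] [MeasurableSingletonClass X]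
    (T : TransferOperator X) {μ κ : Measure X} [SigmaFinite μ] [SigmaFinite κ] (h : μ ≪ κ)
    {f : X → ℝ} (hσ : MemLp (f ∘ T.σ) 2 (T.act μ))
    (hσ' : MemLp ((fun x => f x * sqrtRN μ κ x) ∘ T.σ) 2 (T.act κ)) :
    cls (f ∘ T.σ) (T.act μ) hσ = cls ((fun x => f x * sqrtRN μ κ x) ∘ T.σ) (T.act κ) hσ' := by
  rw [cls_change (T.act_mono_ac h), cls_eq_iff]
  exact T.act_mul_ae h f

theorem HatRel.exists {X : Type*} [MeasurableSpace X] [MeasurableSingletonClass X]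
    {T : TransferOperator X} {u v : UHilbert X} (h : T.HatRel u v) :
    ∃ (μ : Measure X) (_ : SigmaFinite μ), ∀ (κ : Measure X) [SigmaFinite κ], μ ≪ κ →
      ∃ (f : X → ℝ) (hf : MemLp f 2 κ) (hσ : MemLp (f ∘ T.σ) 2 (T.act κ)),
        u = cls f κ hf ∧ v = cls (f ∘ T.σ) (T.act κ) hσ := by
  obtain ⟨μ, _, f, hf, hσ, rfl, rfl⟩ := h
  refine ⟨μ, inferInstance, fun κ _ hκ => ?_⟩
  have h2 := (T.memLp_act_change hκ hf).2 hσ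
  exact ⟨_, _, h2, cls_change hκ hf, T.cls_act_change hκ hσ h2⟩

theorem HatRel.exists₂ {X : Type*} [MeasurableSpace X] [MeasurableSingletonClass X]
    {T : TransferOperator X} {u v u' v' : UHilbert X} (h : T.HatRel u v) (h' : T.HatRel u' v') :
    ∃ (κ : Measure X) (_ : SigmaFinite κ) (f g : X → ℝ) (hf : MemLp f 2 κ) (hg : MemLp g 2 κ)
      (hfσ : MemLp (f ∘ T.σ) 2 (T.act κ)) (hgσ : MemLp (g ∘ T.σ) 2 (T.act κ)),
        u = cls f κ hf ∧ v = cls (f ∘ T.σ) (T.act κ) hfσ ∧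
        u' = cls g κ hg ∧ v' = cls (g ∘ T.σ) (T.act κ) hgσ := by
  obtain ⟨μ, _, h⟩ := h.exists
  obtain ⟨ν, _, h'⟩ := h'.exists
  obtain ⟨f, hf, hfσ, rfl, rfl⟩ := h _ (ac_left μ ν)
  obtain ⟨g, hg, hgσ, rfl, rfl⟩ := h' _ (ac_right μ ν)
  exact ⟨μ + ν, inferInstance, f, g, hf, hg, hfσ, hgσ, rfl, rfl, rfl, rfl⟩

theorem HatRel.unique {X : Type*} [MeasurableSpace X] [MeasurableSingletonClass X]
    {T : TransferOperator X} {u v v' : UHilbert X} (h : T.HatRel u v) (h' : T.HatRel u v') :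
    v = v' := by
  obtain ⟨κ, _, f, g, hf, hg, hfσ, hgσ, rfl, rfl, e, rfl⟩ := h.exists₂ h'
  rw [cls_eq_iff] at e ⊢
  exact (T.quasi κ).ae_eq e

theorem HatRel.add {X : Type*} [MeasurableSpace X] [MeasurableSingletonClass X]
    {T : TransferOperator X} {u v u' v' : UHilbert X} (h : T.HatRel u v) (h' : T.HatRel u' v') :
    T.HatRel (u + u') (v + v') := by
  obtain ⟨κ, _, f, g, hf, hg, hfσ, hgσ, rfl, rfl, rfl, rfl⟩ := h.exists₂ h'
  exact ⟨κ, inferInstance, fun x => f x + g x, hf.add hg, hfσ.add hgσ, cls_add hf hg,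
    cls_add hfσ hgσ⟩

theorem HatRel.smul {X : Type*} [MeasurableSpace X] [MeasurableSingletonClass X]
    {T : TransferOperator X} {u v : UHilbert X} (c : ℝ) (h : T.HatRel u v) :
    T.HatRel (c • u) (c • v) := by
  obtain ⟨κ, _, f, hf, hfσ, rfl, rfl⟩ := h
  exact ⟨κ, inferInstance, fun x => c * f x, hf.const_mul c, hfσ.const_mul c, cls_smul c hf,
    cls_smul c hfσ⟩

theorem HatRel.zero {X : Type*} [MeasurableSpace X] [MeasurableSingletonClass X]
    (T : TransferOperator X) : T.HatRel 0 0 :=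
  ⟨0, inferInstance, fun _ => 0, MemLp.zero', MemLp.zero', zero_eq_cls 0, zero_eq_cls _⟩

/-- The operator `Ŝ (f √dμ) = (f ∘ σ) √d(μR)` of `ℋ(X)`. Its domain consists of all
classes `f √dμ` with `f ∘ σ ∈ L²(μR)`. -/
def hatS {X : Type*} [MeasurableSpace X] [MeasurableSingletonClass X]
    (T : TransferOperator X) : UHilbert X →ₗ.[ℝ] UHilbert X where
  domain :=
    { carrier := {u | ∃ v, T.HatRel u v}
      add_mem' := fun ⟨_, h⟩ ⟨_, h'⟩ => ⟨_, h.add h'⟩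
      zero_mem' := ⟨_, HatRel.zero T⟩
      smul_mem' := fun c _ ⟨_, h⟩ => ⟨_, h.smul c⟩ }
  toFun :=
    { toFun := fun u => u.2.choose
      map_add' := fun u u' =>
        (u + u').2.choose_spec.unique (u.2.choose_spec.add u'.2.choose_spec)
      map_smul' := fun c u => (c • u).2.choose_spec.unique (u.2.choose_spec.smul c) }

theorem mem_domain_hatS {X : Type*} [MeasurableSpace X] [MeasurableSingletonClass X]
    (T : TransferOperator X) {μ : Measure X} [SigmaFinite μ] {f : X → ℝ} (hf : MemLp f 2 μ) :
    cls f μ hf ∈ T.hatS.domain ↔ MemLp (f ∘ T.σ) 2 (T.act μ) := by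
  constructor
  · rintro ⟨v, h⟩
    obtain ⟨ν, _, h⟩ := h.exists
    obtain ⟨g, hg, hgσ, e, -⟩ := h _ (ac_right μ ν)
    rw [cls_change (ac_left μ ν), cls_eq_iff] at e
    rw [← T.memLp_act_change (ac_left μ ν) hf]
    exact (memLp_congr_ae ((T.quasi (μ + ν)).ae_eq e)).2 hgσ
  · intro h
    exact ⟨_, μ, inferInstance, f, hf, h, rfl, rfl⟩

theorem hatS_cls {X : Type*} [MeasurableSpace X] [MeasurableSingletonClass X]
    (T : TransferOperator X) {μ : Measure X} [SigmaFinite μ] {f : X → ℝ} (hf : MemLp f 2 μ)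
    (hσ : MemLp (f ∘ T.σ) 2 (T.act μ)) :
    T.hatS ⟨cls f μ hf, (T.mem_domain_hatS hf).2 hσ⟩ = cls (f ∘ T.σ) (T.act μ) hσ :=
  HatRel.unique (T := T) (Exists.choose_spec ((T.mem_domain_hatS hf).2 hσ))
    ⟨μ, inferInstance, f, hf, hσ, rfl, rfl⟩

/-- The set `𝓛(R)` of all σ-finite measures `μ` with `μR ≪ μ`. -/
def LSet {X : Type*} [MeasurableSpace X] (T : TransferOperator X) : Set (Measure X) :=
  {μ | SigmaFinite μ ∧ T.act μ ≪ μ}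

end TransferOperator

end

end UniversalHilbert

namespace UniversalHilbert

/-! Order continuity makes A ↦ R(χ_A)(x) a finite measure `T.ker x`, of total mass R(1)(x), and the
pull-out property concentrates it on the fibre σ⁻¹(x). The measure μR is the μ-average of these
fibre measures, so a factor φ∘σ is constant for each of them and comes out of the inner integral: ∫
(φ∘σ) g d(μR) = ∫ φ(x) (∫ g d(ker x)) dμ(x). This is `lintegral_act_mul`, and both directions of the
isometry statement rest on this kernel description.

With g = 1 it says that σ pushes μR forward to R(1)·μ. In terms of norms, ‖Ŝ(f√dμ)‖² = ∫ f² R(1) dμ,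
against ‖f√dμ‖² = ∫ f² dμ. If R(1) = 1, then σ is measure preserving from μR to μ for every μ, so
f∘σ is always in L²(μR) and has the norm of f: Ŝ is everywhere defined and isometric.

For the converse, the universal space contains a unit vector √dδ_x for every point x. Its image has
squared norm R(1)(x), the mass of δ_x R. An isometric Ŝ therefore forces R(1)(x) = 1 at each x;
point masses are what give the equality everywhere and not only almost everywhere.

Invariance is independent of this. If μR ≪ μ, then (f∘σ)√d(μR) can be rewritten over μ as
(f∘σ)√(d(μR)/dμ) √dμ, which is visibly in ℋ(μ). -/

theorem norm_cls_sq {X : Type*} [MeasurableSpace X] {μ : Measure X} [SigmaFinite μ]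
    {f : X → ℝ} (hf : MemLp f 2 μ) : ‖cls f μ hf‖ ^ 2 = ∫ x, f x * f x ∂μ := by
  rw [← real_inner_self_eq_norm_sq]
  exact cls_inner hf hf

namespace TransferOperator

/-! ### Sufficiency: the case R(1) = 1 -/

/-- The characteristic function of the whole space is the constant 1. This is how R(1) enters as the
density of the pushforward of μR under σ. -/
theorem ker_univ {X : Type*} [MeasurableSpace X] (T : TransferOperator X) (x : X) :
    T.ker x Set.univ = ENNReal.ofReal ((T.R T.one).1 x) := by
  have hu : T.chi Set.univ MeasurableSet.univ = T.one :=
    Subtype.ext (by rw [chi_val]; simp [one])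
  rw [T.ker_apply x MeasurableSet.univ, hu]

/-- If `R(1) = 1`, then `σ` maps `μR` to `μ`. -/
theorem measurePreserving_of_R_one {X : Type*} [MeasurableSpace X] [MeasurableSingletonClass X]
    (T : TransferOperator X) (h : (T.R T.one).1 = 1) (μ : Measure X) :
    MeasurePreserving T.σ (T.act μ) μ := by
  refine ⟨T.measurable_σ, ?_⟩
  ext B hB
  rw [Measure.map_apply T.measurable_σ hB]
  -- For φ = χ_B and g = 1 the fibre formula reads (μR)(σ⁻¹B) = ∫_B R(1) dμ, and the right side is
  -- μ(B) once R(1) = 1.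
  have e := T.lintegral_act_mul μ (φ := B.indicator 1) (g := fun _ => 1)
    (measurable_one.indicator hB) measurable_const
  simp only [mul_one, lintegral_const, T.ker_univ, h, Pi.one_apply,
    ENNReal.ofReal_one, lintegral_indicator_one hB] at e
  rw [← e, ← lintegral_indicator_one (T.measurable_σ hB)]
  -- The functions χ_B ∘ σ and χ_{σ⁻¹B} agree by definition.
  rfl

/-- Composition with a measure-preserving map keeps square integrability, so the condition f∘σ ∈
L²(μR) that defines the domain holds for every representative. -/
theorem domain_hatS_eq_top {X : Type*} [MeasurableSpace X] [MeasurableSingletonClass X]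
    (T : TransferOperator X) (h : (T.R T.one).1 = 1) : T.hatS.domain = ⊤ := by
  refine eq_top_iff.2 fun u _ => ?_
  obtain ⟨μ, _, f, -, hf, -, rfl, -⟩ := exists_cls₂ u u
  exact (T.mem_domain_hatS hf).2 (hf.comp_measurePreserving (T.measurePreserving_of_R_one h μ))

/-- By linearity, preserving distances amounts to preserving norms. The map in question is the
function on the domain, with the metric inherited from ℋ(X), so being an isometry does not by itself
say that Ŝ is everywhere defined. -/
theorem isometry_hatS_iff_norm {X : Type*} [MeasurableSpace X] [MeasurableSingletonClass X]
    (T : TransferOperator X) : Isometry T.hatS ↔ ∀ u : T.hatS.domain, ‖T.hatS u‖ = ‖u‖ :=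
  AddMonoidHomClass.isometry_iff_norm T.hatS.toFun

/-- Comparing squared norms over one representative leaves ∫ f²∘σ d(μR) = ∫ f² dμ, which is the
change of variables along σ. -/
theorem isometry_hatS {X : Type*} [MeasurableSpace X] [MeasurableSingletonClass X]
    (T : TransferOperator X) (h : (T.R T.one).1 = 1) : Isometry T.hatS := by
  rw [isometry_hatS_iff_norm]
  rintro ⟨u, hu⟩
  obtain ⟨μ, _, f, -, hf, -, rfl, -⟩ := exists_cls₂ u u
  have hσ := (T.mem_domain_hatS hf).1 hu
  have hp := T.measurePreserving_of_R_one h μ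
  rw [T.hatS_cls hf hσ, Submodule.coe_norm, ← sq_eq_sq₀ (norm_nonneg _) (norm_nonneg _),
    norm_cls_sq, norm_cls_sq]
  -- The map σ need not be injective and f is only a.e. measurable, so the change of variables needs
  -- f² to be a.e. measurable for the pushforward; that measure is μ.
  have hm : AEStronglyMeasurable (fun x => f x * f x) (Measure.map T.σ (T.act μ)) := by
    rw [hp.map_eq]; exact hf.1.mul hf.1
  have e := integral_map T.measurable_σ.aemeasurable hm
  rw [hp.map_eq] at e
  exact e.symm

/-! ### Necessity: testing on point masses -/

/-- Averaging the fibre measures against a point mass selects a single one of them. -/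
theorem act_dirac {X : Type*} [MeasurableSpace X] (T : TransferOperator X) (x : X) :
    T.act (Measure.dirac x) = T.ker x := by
  rw [act_eq_bind, Measure.dirac_bind T.measurable_ker]

/-- The test vector at x is √dδ_x: its squared norm is 1, and that of its image is the total mass
R(1)(x) of δ_x R. -/
theorem R_one_of_isometry_hatS {X : Type*} [MeasurableSpace X] [MeasurableSingletonClass X]
    (T : TransferOperator X) (h : Isometry T.hatS) : (T.R T.one).1 = 1 := by
  rw [isometry_hatS_iff_norm] at h
  funext x
  have hR : 0 ≤ (T.R T.one).1 x := T.nonneg _ (fun _ => zero_le_one) x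
  have hker : T.act (Measure.dirac x) Set.univ = ENNReal.ofReal ((T.R T.one).1 x) := by
    rw [act_dirac, ker_univ]
  -- Finite mass puts the constant 1 in L²(δ_x R), so the test vector lies in the domain of Ŝ.
  have : IsFiniteMeasure (T.act (Measure.dirac x)) := ⟨by rw [hker]; exact ENNReal.ofReal_lt_top⟩
  have hf : MemLp (fun _ : X => (1 : ℝ)) 2 (Measure.dirac x) := memLp_const 1
  have hσ : MemLp ((fun _ : X => (1 : ℝ)) ∘ T.σ) 2 (T.act (Measure.dirac x)) := memLp_const 1
  have e := congrArg (· ^ 2) (h ⟨cls _ _ hf, (T.mem_domain_hatS hf).2 hσ⟩)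
  simp only [T.hatS_cls hf hσ, Submodule.coe_norm, norm_cls_sq] at e
  -- Both sides are integrals of 1, hence total masses. Positivity of R is what lets R(1)(x) be
  -- recovered from its truncation `ENNReal.ofReal`.
  simpa [Measure.real, hker, ENNReal.toReal_ofReal hR] using e

/-! ### Invariance of ℋ(μ) for μ in 𝓛(R) -/

/-- Absolute continuity μR ≪ μ allows the image vector to be represented over μ, the factor
√(d(μR)/dμ) being absorbed into the function. -/
theorem hatS_mem_subspaceOf {X : Type*} [MeasurableSpace X] [MeasurableSingletonClass X]
    (T : TransferOperator X) {μ : Measure X} [SigmaFinite μ] (h : T.act μ ≪ μ)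
    (u : T.hatS.domain) (hu : (u : UHilbert X) ∈ subspaceOf μ) : T.hatS u ∈ subspaceOf μ := by
  obtain ⟨u, hd⟩ := u
  obtain ⟨f, rfl⟩ := hu
  -- The domain only asks for some representative with the square integrability property;
  -- independence of the representative transfers it to the given one over μ.
  have hσ := (T.mem_domain_hatS (Lp.memLp f)).1 hd
  have e : T.hatS ⟨_, hd⟩ = cls (f ∘ T.σ) (T.act μ) hσ := T.hatS_cls (Lp.memLp f) hσ
  rw [e, cls_change h]
  exact cls_mem_subspaceOf _

end TransferOperator

end UniversalHilbert

theorem mainTheorem7 {X : Type*} [MeasurableSpace X] [StandardBorelSpace X]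
    (T : UniversalHilbert.TransferOperator X) :
    ((Isometry T.hatS ↔ (T.R T.one).1 = 1) ∧ ((T.R T.one).1 = 1 → T.hatS.domain = ⊤)) ∧
      ∀ (μ : Measure X) [SigmaFinite μ], μ ∈ T.LSet →
        ∀ u : T.hatS.domain, (u : UniversalHilbert.UHilbert X) ∈ UniversalHilbert.subspaceOf μ →
          T.hatS u ∈ UniversalHilbert.subspaceOf μ :=
  ⟨⟨⟨T.R_one_of_isometry_hatS, T.isometry_hatS⟩, T.domain_hatS_eq_top⟩,
    fun _ _ hμ u hu => T.hatS_mem_subspaceOf hμ.2 u hu⟩
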